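/- Fix integers $1\le q\le p$, a positive definite $p\times p$ matrix $C$ with unit diagonal, a vector $\beta\in\mathbb{R}^p$ with $\beta_j\neq 0$ if and only if $j\le q$, and $v>0$, none of which depends on $n$. Let $z_1,z_2,\dots$ be i.i.d. copies of a random row vector $\mathcal{X}=(X_1,\dots,X_p)$ with mean $0$, finite second moments and covariance matrix $C$, and let $\varepsilon_1,\varepsilon_2,\dots$ be i.i.d. $N(0,v)$, independent of $(z_i)_{i\ge 1}$. For each $n$ let $\bm{X}$ be the $n\times p$ design matrix with rows $x_i$ and columns $\bm{X}_j$ which is either (for all $n$) the matrix with rows $z_1,\dots,z_n$, or (for all $n$) this matrix with each column centred and then rescaled so that $\bm{X}_j^T\bm{X}_j=n$ (a constant column becoming zero). Let $y=\bm{X}\beta+(\varepsilon_1,\dots,\varepsilon_n)^T$. Write $Y=\mathcal{X}\beta+\varepsilon$ with $\varepsilon\sim N(0,v)$ independent of $\mathcal{X}$, and let $\varepsilon_{Y,-j}$ and $\varepsilon_{j,-j}$ be the errors of the best linear predictions of $Y$ and $X_j$ based on $\{X_k:k\ne j\}$. The semi-standard partial covariance (SPAC) is $\gamma_j=\rho_j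 s_j$, where $\rho_j=\mathrm{Corr}(\varepsilon_{Y,-j},\varepsilon_{j,-j})$ and $s_j=\sqrt{\mathrm{Var}(\varepsilon_{Y,-j})}$; put $\gamma=(\gamma_1,\dots,\gamma_p)$ and $\gamma_{(1)}=(\gamma_1,\dots,\gamma_q)^T$. Let $d_{jj}=(C^{-1})_{jj}$, and for each $n$ let $\hat d=(\hat d_{11},\dots,\hat d_{pp})$ be a random vector. For $\lambda\ge 0$ a SPAC-Lasso estimate $\hat\gamma(\lambda)$ is a minimizer over $g\in\mathbb{R}^p$ of $$\tfrac12\Big\|y-\sum_{j=1}^p \bm{X}_j\sqrt{\hat d_{jj}}\,g_j\Big\|^2+\lambda\sum_{j=1}^p\hat d_{jj}|g_j|.$$ Suppose that (C3) $\max_{1\le i\le n}x_ix_i^T=o_p(n)$, and that $\max_{1\le j\le p}|\hat d_{jj}-d_{jj}|=o_p(1/\sqrt n)$. If the SPAC-Lasso is general sign consistent, that is, if $$\lim_{n\to\infty}P\big(\text{there are } \lambda\ge 0 \text{ and a SPAC-Lasso estimate } \hat\gamma(\lambda) \text{ with } \mathrm{sign}(\hat\gamma(\lambda))=\mathrm{sign}(\gamma)\big)=1,$$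 then the transformed weak irrepresentable condition holds: $$\text{(C2)}\qquad \big|V(2)\,C_{21}\,C_{11}^{-1}\,V(1)^{-1}\,\mathrm{sign}(\gamma_{(1)})\big|\le \bm{1}\quad\text{(entrywise)},$$ where $C_{11}$ and $C_{21}$ are the blocks of $C$ with columns $1,\dots,q$ and rows $1,\dots,q$ and $q+1,\dots,p$, respectively, $V(1)=\mathrm{diag}(1/\sqrt{d_{11}},\dots,1/\sqrt{d_{qq}})$ and $V(2)=\mathrm{diag}(1/\sqrt{d_{q+1\,q+1}},\dots,1/\sqrt{d_{pp}})$. -/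

import Mathlib

open MeasureTheory ProbabilityTheory Filter Topology
open scoped NNReal ENNReal Matrix

noncomputable section

namespace SPAC

variable {Ω : Type*} [MeasurableSpace Ω]

/-- The covariance matrix of the random vector `𝒳 = (X₁, …, X_p)`. -/
def covMatrix {p : ℕ} (μ : Measure Ω) (𝒳 : Ω → Fin p → ℝ) : Matrix (Fin p) (Fin p) ℝ :=
  Matrix.of fun j k => covariance (fun ω => 𝒳 ω j) (fun ω => 𝒳 ω k) μ

/-- The coefficients of the best linear predictor of `W` based on
`X_{-j} = {X_k : k ≠ j}`, namely `Cov(X_{-j})⁻¹ Cov(X_{-j}, W)`. -/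
def predCoef {p : ℕ} (μ : Measure Ω) (𝒳 : Ω → Fin p → ℝ) (W : Ω → ℝ) (j : Fin p) :
    {k : Fin p // k ≠ j} → ℝ :=
  ((covMatrix μ 𝒳).toBlock (fun k => k ≠ j) (fun k => k ≠ j))⁻¹ *ᵥ
    fun k => covariance (fun ω => 𝒳 ω k) W μ

/-- The prediction error of `W` based on `X_{-j}` (all variables are centred, so there is no
intercept). -/
def predError {p : ℕ} (μ : Measure Ω) (𝒳 : Ω → Fin p → ℝ) (W : Ω → ℝ) (j : Fin p) : Ω → ℝ :=
  fun ω => W ω - ∑ k : {k : Fin p // k ≠ j}, predCoef μ 𝒳 W j k * 𝒳 ω k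

/-- The correlation of two real random variables. -/
def corr (μ : Measure Ω) (U W : Ω → ℝ) : ℝ :=
  covariance U W μ / (√(variance U μ) * √(variance W μ))

/-- The partial correlation `ρ_j = Corr(ε_Y, ε_j)` between `Y` and `X_j`: the correlation of the
prediction errors of `Y` and `X_j` based on `X_{-j}`. -/
def partialCorr {p : ℕ} (μ : Measure Ω) (𝒳 : Ω → Fin p → ℝ) (Y : Ω → ℝ) (j : Fin p) : ℝ :=
  corr μ (predError μ 𝒳 Y j) (predError μ 𝒳 (fun ω => 𝒳 ω j) j)

/-- `s_j`, the standard deviation of `Y` given `X_{-j}`, i.e. of the prediction error of `Y`. -/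
def residualSD {p : ℕ} (μ : Measure Ω) (𝒳 : Ω → Fin p → ℝ) (Y : Ω → ℝ) (j : Fin p) : ℝ :=
  √(variance (predError μ 𝒳 Y j) μ)

/-- The semi-standard partial covariance `γ_j = ρ_j s_j` between `Y` and `X_j`. -/
def spac {p : ℕ} (μ : Measure Ω) (𝒳 : Ω → Fin p → ℝ) (Y : Ω → ℝ) (j : Fin p) : ℝ :=
  partialCorr μ 𝒳 Y j * residualSD μ 𝒳 Y j

/-- The `n × p` matrix whose rows are the first `n` samples. -/
def sampleMatrix {p : ℕ} (Z : ℕ → Ω → Fin p → ℝ) (n : ℕ) (ω : Ω) : Matrix (Fin n) (Fin p) ℝ :=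
  Matrix.of fun i j => Z i ω j

/-- Column standardization: each column is centred and then scaled to squared norm `n`
(a constant column becomes zero). -/
def standardize {n p : ℕ} (A : Matrix (Fin n) (Fin p) ℝ) : Matrix (Fin n) (Fin p) ℝ :=
  Matrix.of fun i j =>
    (A i j - (∑ l, A l j) / n) / √((∑ l, (A l j - (∑ m, A m j) / n) ^ 2) / n)

/-- The SPAC-Lasso loss
`½ ‖y - ∑ j, X_j √d̂_jj γ_j‖² + lam ∑ j, d̂_jj |γ_j|`; `dh j` stands for `d̂_jj`. -/
def lassoLoss {n p : ℕ} (X : Matrix (Fin n) (Fin p) ℝ) (y : Fin n → ℝ) (dh : Fin p → ℝ)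
    (lam : ℝ) (g : Fin p → ℝ) : ℝ :=
  (1 / 2) * ∑ i, (y i - ∑ j, X i j * √(dh j) * g j) ^ 2 + lam * ∑ j, dh j * |g j|

/-- `g` is a SPAC-Lasso estimate with tuning parameter `lam`: a minimizer of the loss. -/
def IsSPACLasso {n p : ℕ} (X : Matrix (Fin n) (Fin p) ℝ) (y : Fin n → ℝ) (dh : Fin p → ℝ)
    (lam : ℝ) (g : Fin p → ℝ) : Prop :=
  ∀ g' : Fin p → ℝ, lassoLoss X y dh lam g ≤ lassoLoss X y dh lam g'

/-- General sign consistency: the probability that some `lam ≥ 0` gives a SPAC-Lasso estimate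
with the same signs as `γ` tends to `1`. -/
def GeneralSignConsistent {p : ℕ} (μ : Measure Ω) (X : (n : ℕ) → Ω → Matrix (Fin n) (Fin p) ℝ)
    (y : (n : ℕ) → Ω → Fin n → ℝ) (dh : ℕ → Ω → Fin p → ℝ) (γ : Fin p → ℝ) : Prop :=
  Tendsto
    (fun n => μ {ω | ∃ lam : ℝ, 0 ≤ lam ∧ ∃ g : Fin p → ℝ,
      IsSPACLasso (X n ω) (y n ω) (dh n ω) lam g ∧ ∀ j, Real.sign (g j) = Real.sign (γ j)})
    atTop (𝓝 1)

/-- `V = diag (√(1 / d_11), …, √(1 / d_pp))`, where `(d_ij) = C⁻¹`. -/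
def scaleMatrix {p : ℕ} (C : Matrix (Fin p) (Fin p) ℝ) : Matrix (Fin p) (Fin p) ℝ :=
  Matrix.diagonal fun j => √(1 / (C⁻¹) j j)

/-- The transformed weak irrepresentable condition
`|V(2) C₂₁ C₁₁⁻¹ V(1)⁻¹ sign(γ₍₁₎)| ≤ 1` (entrywise), block `1` being the first `q` indices and
block `2` the remaining `p - q`. -/
def WeakIrrepresentable {p : ℕ} (q : ℕ) (C : Matrix (Fin p) (Fin p) ℝ) (γ : Fin p → ℝ) : Prop :=
  ∀ j : {j : Fin p // ¬ (j : ℕ) < q},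
    |(((scaleMatrix C).toBlock (fun k => ¬ (k : ℕ) < q) (fun k => ¬ (k : ℕ) < q) *
        C.toBlock (fun k => ¬ (k : ℕ) < q) (fun k => (k : ℕ) < q) *
        (C.toBlock (fun k => (k : ℕ) < q) (fun k => (k : ℕ) < q))⁻¹ *
        ((scaleMatrix C).toBlock (fun k => (k : ℕ) < q) (fun k => (k : ℕ) < q))⁻¹) *ᵥ
      (fun k => Real.sign (γ k))) j| ≤ 1

end SPAC

end

/-! ### Stationarity conditions for the SPAC-Lasso. -/

namespace SPAC

/-! Suppose the condition fails at an inactive index `j`, with sign `σ`. Let `u` be the residual of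
column `j` after regression on the active columns. If an estimate has the signs of `γ`, its fit and
the true signal both lie in the span of the active columns. Hence `u` has the same inner product
with the Lasso residual as with the noise. The stationarity conditions evaluate this product: an
active score is exactly `λ√d̂` times a sign, while the score at `j` is at most `λ√d̂` in absolute
value. The violated inequality then forces `σ⟨u, ε⟩ ≤ 0`, whatever `λ ≥ 0` is
(`IsSPACLasso.sum_residColumn_mul_nonpos`).

Given the design, `⟨u, ε⟩` is a centred Gaussian, nondegenerate when `u ≠ 0`, so the opposite sign
has probability one half (`half_mul_measure_le_of_indepFun`). Sign recovery thus has probability at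
most `1/2 + o(1)`, a contradiction. The bound is deterministic in `λ` and `d̂`, so both may depend
on the noise.

The violation passes from the population to the sample because it is an open condition on the Gram
matrix and the scales (`isOpen_violationSet`), which converge to `C` and to the diagonal of `C⁻¹`.
Finally, `γ_j` is `β_j` times a positive number (`spac_eq_mul_sqrt_variance`), so `γ` and `β` have
the same support. -/

lemma le_of_forall_pos_le_add_mul {a b c r : ℝ} (hr : 0 < r)
    (h : ∀ t, 0 < t → t < r → a ≤ b + t * c) : a ≤ b := by
  have hlim : Tendsto (fun t : ℝ => b + t * c) (𝓝[>] 0) (𝓝 b) := by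
    have : Tendsto (fun t : ℝ => b + t * c) (𝓝 0) (𝓝 (b + 0 * c)) :=
      (by fun_prop : Continuous fun t : ℝ => b + t * c).tendsto 0
    simpa using this.mono_left nhdsWithin_le_nhds
  refine ge_of_tendsto hlim ?_
  filter_upwards [Ioo_mem_nhdsGT hr] with t ht using h t ht.1 ht.2

/-- Optimality at a kink: divide by `|t|` and let `t` tend to zero from either side; the quadratic
term vanishes. -/
lemma abs_le_of_abs_penalized_nonneg {a b c : ℝ}
    (h : ∀ t : ℝ, 0 ≤ -t * a + t ^ 2 * b + c * |t|) : |a| ≤ c := by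
  refine abs_le'.2 ⟨le_of_forall_pos_le_add_mul (c := b) one_pos fun t ht _ => ?_,
    le_of_forall_pos_le_add_mul (c := b) one_pos fun t ht _ => ?_⟩
  · have := h t
    rw [abs_of_pos ht] at this
    nlinarith
  · have := h (-t)
    rw [abs_neg, abs_of_pos ht] at this
    nlinarith

/-- Away from zero the absolute value is locally linear with slope `Real.sign x`, so the two
one-sided bounds combine to an equality. -/
lemma eq_mul_sign_of_abs_penalized_nonneg {a b c x : ℝ} (hx : x ≠ 0)
    (h : ∀ t : ℝ, 0 ≤ -t * a + t ^ 2 * b + c * (|x + t| - |x|)) : a = c * Real.sign x := by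
  have key : ∀ t : ℝ, |t| < |x| → |x + t| - |x| = t * Real.sign x := by
    intro t ht
    rcases hx.lt_or_gt with hx | hx
    · rw [abs_of_neg hx] at ht ⊢
      rw [Real.sign_of_neg hx, abs_of_neg (by linarith [(abs_lt.1 ht).2])]
      ring
    · rw [abs_of_pos hx] at ht ⊢
      rw [Real.sign_of_pos hx, abs_of_pos (by linarith [(abs_lt.1 ht).1])]
      ring
  have hr : 0 < |x| := abs_pos.2 hx
  apply le_antisymm
  · refine le_of_forall_pos_le_add_mul (c := b) hr fun t ht htr => ?_
    have := h t
    rw [key t (by rwa [abs_of_pos ht])] at this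
    nlinarith
  · refine le_of_forall_pos_le_add_mul (c := b) hr fun t ht htr => ?_
    have := h (-t)
    rw [key (-t) (by rwa [abs_neg, abs_of_pos ht])] at this
    nlinarith

lemma sum_sub_mul_sq {ι : Type*} [Fintype ι] (r x : ι → ℝ) (s t : ℝ) :
    ∑ i, (r i - x i * s * t) ^ 2 =
      ∑ i, r i ^ 2 - 2 * t * (s * ∑ i, x i * r i) + t ^ 2 * (s ^ 2 * ∑ i, x i ^ 2) := by
  simp only [Finset.mul_sum, ← Finset.sum_sub_distrib, ← Finset.sum_add_distrib]
  exact Finset.sum_congr rfl fun i _ => by ring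

variable {n p : ℕ} {X : Matrix (Fin n) (Fin p) ℝ} {y : Fin n → ℝ} {dh : Fin p → ℝ} {lam : ℝ}
  {g : Fin p → ℝ}

lemma lassoLoss_update (j : Fin p) (hj : 0 ≤ dh j) (t : ℝ) :
    lassoLoss X y dh lam (Function.update g j (g j + t)) - lassoLoss X y dh lam g =
      -t * (√(dh j) * ∑ i, X i j * (y i - ∑ k, X i k * √(dh k) * g k)) +
        t ^ 2 * ((1 / 2) * (dh j * ∑ i, X i j ^ 2)) + lam * dh j * (|g j + t| - |g j|) := by
  have h1 : ∀ i, ∑ k, X i k * √(dh k) * Function.update g j (g j + t) k =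
      ∑ k, X i k * √(dh k) * g k + X i j * √(dh j) * t := by
    intro i
    rw [← Finset.add_sum_erase _ _ (Finset.mem_univ j),
      ← Finset.add_sum_erase _ (fun k => X i k * √(dh k) * g k) (Finset.mem_univ j),
      Finset.sum_congr rfl fun k hk => by rw [Function.update_of_ne (Finset.ne_of_mem_erase hk)]]
    simp only [Function.update_self]
    ring
  have h2 : ∑ k, dh k * |Function.update g j (g j + t) k| =
      ∑ k, dh k * |g k| + dh j * (|g j + t| - |g j|) := by
    rw [← Finset.add_sum_erase _ _ (Finset.mem_univ j),
      ← Finset.add_sum_erase _ (fun k => dh k * |g k|) (Finset.mem_univ j),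
      Finset.sum_congr rfl fun k hk => by rw [Function.update_of_ne (Finset.ne_of_mem_erase hk)]]
    simp only [Function.update_self]
    ring
  have h3 : ∑ i, (y i - (∑ k, X i k * √(dh k) * g k + X i j * √(dh j) * t)) ^ 2 =
      ∑ i, (y i - ∑ k, X i k * √(dh k) * g k) ^ 2
        - 2 * t * (√(dh j) * ∑ i, X i j * (y i - ∑ k, X i k * √(dh k) * g k))
        + t ^ 2 * (dh j * ∑ i, X i j ^ 2) := by
    have := sum_sub_mul_sq (fun i => y i - ∑ k, X i k * √(dh k) * g k) (fun i => X i j)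
      (√(dh j)) t
    rw [Real.sq_sqrt hj] at this
    rw [← this]
    exact Finset.sum_congr rfl fun i _ => by ring
  unfold lassoLoss
  simp only [h1, h2, h3]
  ring

lemma IsSPACLasso.penalized_nonneg (h : IsSPACLasso X y dh lam g) (j : Fin p) (hj : 0 ≤ dh j)
    (t : ℝ) :
    0 ≤ -t * (√(dh j) * ∑ i, X i j * (y i - ∑ k, X i k * √(dh k) * g k)) +
        t ^ 2 * ((1 / 2) * (dh j * ∑ i, X i j ^ 2)) + lam * dh j * (|g j + t| - |g j|) := by
  rw [← lassoLoss_update j hj t]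
  exact sub_nonneg.2 (h _)

/-- The gradient carries a factor `√d̂` and the penalty a factor `d̂`. The surviving `√d̂` is the
source of the matrices `V` in the irrepresentable condition. -/
lemma IsSPACLasso.score_eq (h : IsSPACLasso X y dh lam g) {j : Fin p} (hj : 0 < dh j)
    (hg : g j ≠ 0) :
    ∑ i, X i j * (y i - ∑ k, X i k * √(dh k) * g k) = lam * (√(dh j) * Real.sign (g j)) := by
  have := eq_mul_sign_of_abs_penalized_nonneg hg (h.penalized_nonneg j hj.le)
  refine mul_left_cancel₀ (Real.sqrt_pos.2 hj).ne' (this.trans ?_)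
  linear_combination -(lam * Real.sign (g j)) * Real.mul_self_sqrt hj.le

lemma IsSPACLasso.abs_score_le (h : IsSPACLasso X y dh lam g) {j : Fin p} (hj : 0 < dh j)
    (hg : g j = 0) :
    |∑ i, X i j * (y i - ∑ k, X i k * √(dh k) * g k)| ≤ lam * √(dh j) := by
  have := abs_le_of_abs_penalized_nonneg fun t => by
    simpa [hg] using h.penalized_nonneg j hj.le t
  have hs := Real.sqrt_pos.2 hj
  rw [abs_mul, abs_of_pos hs] at this
  refine le_of_mul_le_mul_left (this.trans_eq ?_) hs
  linear_combination -lam * Real.mul_self_sqrt hj.le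

end SPAC

/-! ### Inverse-free regression residuals and the deterministic sign constraint. -/

namespace SPAC

section ResidCoef

variable {ι : Type*} [Fintype ι] [DecidableEq ι] (P : ι → Prop) [DecidablePred P]

/-- The projection coefficients, scaled by the determinant of the block `P` of `S`, in terms of
which the residual of the variable `j` given the variables in `P` is free of inverses. -/
def projCoef (j : ι) (S : Matrix ι ι ℝ) : {k // P k} → ℝ :=
  (S.toBlock P P).adjugate *ᵥ fun k => S k j

/-- The coefficients of the residual of the variable `j` given the variables in `P`, scaled by the
determinant of the block `P` of `S`. -/
def residCoef (j : ι) (S : Matrix ι ι ℝ) (k : ι) : ℝ :=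
  (if k = j then (S.toBlock P P).det else 0) - if h : P k then projCoef P j S ⟨k, h⟩ else 0

lemma sum_mul_residCoef (j : ι) (S : Matrix ι ι ℝ) (f : ι → ℝ) :
    ∑ k, f k * residCoef P j S k =
      f j * (S.toBlock P P).det - ∑ k : {k // P k}, f k * projCoef P j S k := by
  have h : ∑ k : {k // P k}, f k * projCoef P j S k =
      ∑ k, f k * (if h : P k then projCoef P j S ⟨k, h⟩ else 0) := by
    rw [← Fintype.sum_subtype_add_sum_subtype P]
    have h0 : ∑ k : {k // ¬ P k}, f k * (if h : P k then projCoef P j S ⟨k, h⟩ else 0) = 0 :=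
      Finset.sum_eq_zero fun k _ => by rw [dif_neg k.2, mul_zero]
    rw [h0, add_zero]
    exact Finset.sum_congr rfl fun k _ => by rw [dif_pos k.2]
  rw [h]
  simp [residCoef, mul_sub, Finset.sum_sub_distrib]

/-- These are the normal equations. Using the adjugate keeps them valid for a singular block and
makes the coefficients polynomial in `S`, hence continuous. -/
lemma mulVec_residCoef (j : ι) (S : Matrix ι ι ℝ) {l : ι} (hl : P l) :
    (S *ᵥ residCoef P j S) l = 0 := by
  have h : (S.toBlock P P *ᵥ projCoef P j S) ⟨l, hl⟩ = (S.toBlock P P).det * S l j := by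
    rw [projCoef, Matrix.mulVec_mulVec, Matrix.mul_adjugate, Matrix.smul_mulVec,
      Matrix.one_mulVec]
    simp
  have h' : (S.toBlock P P *ᵥ projCoef P j S) ⟨l, hl⟩ =
      ∑ k : {k // P k}, S l k * projCoef P j S k := rfl
  have h'' : (S *ᵥ residCoef P j S) l = ∑ k, S l k * residCoef P j S k := rfl
  rw [h'', sum_mul_residCoef, ← h', h]
  ring

lemma residCoef_self {j : ι} (hj : ¬ P j) (S : Matrix ι ι ℝ) :
    residCoef P j S j = (S.toBlock P P).det := by
  simp [residCoef, hj]

lemma continuous_projCoef (j : ι) : Continuous (projCoef P j) := by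
  refine (continuous_id.matrix_submatrix _ _).matrix_adjugate.matrix_mulVec ?_
  exact continuous_pi fun k => continuous_id.matrix_elem _ _

lemma continuous_residCoef (j : ι) : Continuous (residCoef P j) := by
  refine continuous_pi fun k => Continuous.sub ?_ ?_
  · split_ifs
    · exact (continuous_id.matrix_submatrix _ _).matrix_det
    · exact continuous_const
  · split_ifs with h
    · exact (continuous_apply _).comp (continuous_projCoef P j)
    · exact continuous_const

end ResidCoef

variable {n p : ℕ}

/-- The Gram matrix `Xᵀ X / n`. -/
noncomputable def gram (X : Matrix (Fin n) (Fin p) ℝ) : Matrix (Fin p) (Fin p) ℝ :=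
  Matrix.of fun j k => (∑ i, X i j * X i k) / n

lemma gram_mulVec (X : Matrix (Fin n) (Fin p) ℝ) (c : Fin p → ℝ) (l : Fin p) :
    (gram X *ᵥ c) l = (∑ i, X i l * (X *ᵥ c) i) / n := by
  simp only [gram, Matrix.mulVec, dotProduct, Matrix.of_apply, Finset.mul_sum, Finset.sum_div,
    div_mul_eq_mul_div, Finset.sum_mul]
  rw [Finset.sum_comm]
  exact Finset.sum_congr rfl fun i _ => Finset.sum_congr rfl fun k _ => by ring

/-- The residual of the column `j` after regression on the columns in `P`, scaled by a
determinant. -/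
noncomputable def residColumn (P : Fin p → Prop) [DecidablePred P] (j : Fin p)
    (X : Matrix (Fin n) (Fin p) ℝ) : Fin n → ℝ :=
  X *ᵥ residCoef P j (gram X)

variable (P : Fin p → Prop) [DecidablePred P]

lemma sum_mul_residColumn_eq_zero (j : Fin p) (X : Matrix (Fin n) (Fin p) ℝ) {l : Fin p}
    (hl : P l) : ∑ i, X i l * residColumn P j X i = 0 := by
  -- For `n = 0` the Gram matrix is a division by zero and says nothing, but the sum is empty.
  rcases Nat.eq_zero_or_pos n with rfl | hn
  · simp
  have h := mulVec_residCoef P j (gram X) hl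
  rw [gram_mulVec, div_eq_zero_iff] at h
  exact h.resolve_right (by positivity)

lemma residColumn_ne_zero {j : Fin p} (hj : ¬ P j) {X : Matrix (Fin n) (Fin p) ℝ}
    (h1 : ((gram X).toBlock P P).det ≠ 0) (h2 : (gram X).det ≠ 0) : residColumn P j X ≠ 0 := by
  intro h
  have h0 : gram X *ᵥ residCoef P j (gram X) = 0 := by
    funext l
    rw [gram_mulVec, ← residColumn, h]
    simp
  have := congrFun (Matrix.eq_zero_of_mulVec_eq_zero h2 h0) j
  rw [residCoef_self P hj] at this
  exact h1 this

/-- Pair the Lasso residual with `residColumn` in two ways. Orthogonality to the active columns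
leaves only the noise; expanding `residColumn` in the columns of `X` leaves scores, which
stationarity controls. `hviol` makes the second expression, times `σ`, nonpositive. -/
lemma IsSPACLasso.sum_residColumn_mul_nonpos {P} [DecidablePred P] {X : Matrix (Fin n) (Fin p) ℝ}
    {y e : Fin n → ℝ} {β dh g s : Fin p → ℝ} {lam : ℝ} (hlam : 0 ≤ lam)
    (hy : ∀ i, y i = ∑ k, X i k * β k + e i) (h : IsSPACLasso X y dh lam g)
    (hdh : ∀ k, 0 < dh k) (hg : ∀ k, P k → g k ≠ 0 ∧ Real.sign (g k) = s k)
    (hg0 : ∀ k, ¬ P k → g k = 0) (hβ : ∀ k, ¬ P k → β k = 0) {j : Fin p} (hj : ¬ P j) {σ : ℝ}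
    (hσ : |σ| = 1) (hdet : 0 ≤ ((gram X).toBlock P P).det)
    (hviol : ((gram X).toBlock P P).det * √(dh j) ≤
      σ * ∑ k : {k // P k}, √(dh k) * s k * projCoef P j (gram X) k) :
    σ * ∑ i, residColumn P j X i * e i ≤ 0 := by
  set u := residColumn P j X with hu
  set A : Fin p → ℝ := fun k => ∑ i, X i k * (y i - ∑ l, X i l * √(dh l) * g l) with hA
  have h1 : ∑ i, u i * (y i - ∑ l, X i l * √(dh l) * g l) = ∑ i, u i * e i := by
    have hr : ∀ i, y i - ∑ l, X i l * √(dh l) * g l =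
        e i + ∑ l, (β l - √(dh l) * g l) * X i l := by
      intro i
      rw [hy]
      simp only [sub_mul, Finset.sum_sub_distrib]
      rw [Finset.sum_congr rfl fun l _ => mul_comm (β l) (X i l),
        Finset.sum_congr rfl fun l _ => (by ring : √(dh l) * g l * X i l = X i l * √(dh l) * g l)]
      ring
    simp only [hr, mul_add, Finset.sum_add_distrib, Finset.mul_sum]
    rw [Finset.sum_comm, add_eq_left]
    refine Finset.sum_eq_zero fun l _ => ?_
    by_cases hl : P l
    · rw [Finset.sum_congr rfl fun i _ => (by ring : u i * ((β l - √(dh l) * g l) * X i l) =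
        (β l - √(dh l) * g l) * (X i l * u i)), ← Finset.mul_sum,
        sum_mul_residColumn_eq_zero P j X hl, mul_zero]
    · exact Finset.sum_eq_zero fun i _ => by rw [hβ l hl, hg0 l hl]; ring
  have h2 : ∑ i, u i * (y i - ∑ l, X i l * √(dh l) * g l) =
      ∑ k, A k * residCoef P j (gram X) k := by
    simp only [hA, hu, residColumn, Matrix.mulVec, dotProduct, Finset.sum_mul]
    rw [Finset.sum_comm]
    exact Finset.sum_congr rfl fun i _ => Finset.sum_congr rfl fun k _ => by
      ring
  have h3 : ∑ k : {k // P k}, A k * projCoef P j (gram X) k =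
      lam * ∑ k : {k // P k}, √(dh k) * s k * projCoef P j (gram X) k := by
    rw [Finset.mul_sum]
    refine Finset.sum_congr rfl fun k _ => ?_
    rw [hA, ← (hg k k.2).2]
    simp only [h.score_eq (hdh k) (hg k k.2).1]
    ring
  rw [← h1, h2, sum_mul_residCoef, h3]
  have h4 : σ * A j ≤ lam * √(dh j) := by
    refine (le_abs_self _).trans ?_
    rw [abs_mul, hσ, one_mul]
    exact h.abs_score_le (hdh j) (hg0 j hj)
  have h5 := mul_le_mul_of_nonneg_right h4 hdet
  have h6 := mul_le_mul_of_nonneg_left hviol hlam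
  nlinarith

end SPAC

/-! ### Symmetric Gaussian noise and conditioning on the design. -/

namespace SPAC

variable {Ω : Type*} [MeasurableSpace Ω] {μ : Measure Ω}

lemma gaussianReal_zero_Ioi {v : ℝ≥0} (hv : v ≠ 0) : gaussianReal 0 v (Set.Ioi 0) = 2⁻¹ := by
  have := nullSingletonClass_gaussianReal (μ := 0) hv
  have h1 : gaussianReal 0 v (Set.Iio 0) = gaussianReal 0 v (Set.Ioi 0) := by
    have h := gaussianReal_map_neg (μ := 0) (v := v)
    rw [neg_zero] at h
    rw [← h, Measure.map_apply measurable_neg measurableSet_Iio, h]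
    congr 1
    ext x
    simp
  have h2 : gaussianReal 0 v (Set.Iio 0) + gaussianReal 0 v (Set.Ioi 0) = 1 := by
    rw [measure_congr (Iio_ae_eq_Iic (μ := gaussianReal 0 v) (a := (0 : ℝ))), ← Set.compl_Ioi,
      add_comm]
    exact prob_add_prob_compl measurableSet_Ioi
  rw [h1, ← two_mul] at h2
  exact ENNReal.eq_inv_of_mul_eq_one_left (by rwa [mul_comm] at h2)

lemma memLp_two_of_gaussian {e : Ω → ℝ} (he : Measurable e) {v : ℝ≥0}
    (hlaw : μ.map e = gaussianReal 0 v) : MemLp e 2 μ := by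
  have h := memLp_id_gaussianReal' (μ := 0) (v := v) 2 (by simp)
  rw [← hlaw] at h
  exact (memLp_map_measure_iff aestronglyMeasurable_id he.aemeasurable).1 h

lemma variance_of_gaussian {e : Ω → ℝ} (he : Measurable e) {v : ℝ≥0}
    (hlaw : μ.map e = gaussianReal 0 v) : variance e μ = v := by
  have h := variance_id_gaussianReal (μ := 0) (v := v)
  rwa [← hlaw, variance_map aemeasurable_id he.aemeasurable, Function.id_comp] at h

lemma integral_of_gaussian {e : Ω → ℝ} (he : Measurable e) {v : ℝ≥0}
    (hlaw : μ.map e = gaussianReal 0 v) : ∫ ω, e ω ∂μ = 0 := by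
  have h := integral_id_gaussianReal (μ := 0) (v := v)
  rw [← hlaw] at h
  rwa [← integral_map he.aemeasurable (f := fun x => x) aestronglyMeasurable_id]

lemma measure_sum_mul_gaussian_pos [IsProbabilityMeasure μ] {v : ℝ≥0} (hv : 0 < v)
    {n : ℕ} {e : Fin n → Ω → ℝ} (hmeas : ∀ i, Measurable (e i)) (hindep : iIndepFun e μ)
    (hlaw : ∀ i, μ.map (e i) = gaussianReal 0 v) {a : Fin n → ℝ} (ha : a ≠ 0) :
    μ {ω | 0 < ∑ i, a i * e i ω} = 2⁻¹ := by
  have hG : ∀ i, HasGaussianLaw (fun ω => a i * e i ω) μ := fun i =>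
    (HasLaw.hasGaussianLaw ⟨(hmeas i).aemeasurable, hlaw i⟩).fun_smul (a i)
  have hI : iIndepFun (fun i ω => a i * e i ω) μ :=
    hindep.comp (fun i x => a i * x) fun i => measurable_const_mul _
  have hL : ∀ i, MemLp (fun ω => a i * e i ω) 2 μ := fun i =>
    (memLp_two_of_gaussian (hmeas i) (hlaw i)).const_mul _
  have hmap := (hI.hasGaussianLaw_fun_sum hG).map_eq_gaussianReal
  have hmean : ∫ ω, ∑ i, a i * e i ω ∂μ = 0 := by
    rw [integral_finsetSum _ fun i _ => (hL i).integrable (by norm_num)]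
    refine Finset.sum_eq_zero fun i _ => ?_
    rw [integral_const_mul, integral_of_gaussian (hmeas i) (hlaw i), mul_zero]
  have hvar : variance (fun ω => ∑ i, a i * e i ω) μ = ∑ i, a i ^ 2 * v := by
    have h := IndepFun.variance_sum (X := fun i ω => a i * e i ω) (s := Finset.univ) (μ := μ)
      (fun i _ => hL i) fun i _ j _ hij => hI.indepFun hij
    rw [show (fun ω => ∑ i, a i * e i ω) = ∑ i, fun ω => a i * e i ω by ext; simp, h]
    refine Finset.sum_congr rfl fun i _ => ?_
    rw [variance_const_mul, variance_of_gaussian (hmeas i) (hlaw i)]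
  have hpos : 0 < ∑ i, a i ^ 2 * (v : ℝ) := by
    obtain ⟨i, hi⟩ := Function.ne_iff.1 ha
    have hi' : a i ≠ 0 := hi
    refine Finset.sum_pos' (fun i _ => by positivity) ⟨i, Finset.mem_univ _, ?_⟩
    have : (0 : ℝ) < v := hv
    positivity
  rw [hmean, hvar] at hmap
  have hm : Measurable fun ω => ∑ i, a i * e i ω :=
    Finset.measurable_sum _ fun i _ => (hmeas i).const_mul _
  have := gaussianReal_zero_Ioi (v := (∑ i, a i ^ 2 * (v : ℝ)).toNNReal) (by simpa using hpos)
  rw [← hmap, Measure.map_apply hm measurableSet_Ioi] at this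
  exact this

/-- By independence the joint law is a product, so Fubini freezes the coefficients `u (T ω)` and
`hhalf` applies on each fibre where they are nonzero. -/
lemma half_mul_measure_le_of_indepFun [IsProbabilityMeasure μ] {α : Type*} [MeasurableSpace α]
    {n : ℕ} {T : Ω → α} (hT : Measurable T) {E : Ω → Fin n → ℝ} (hE : Measurable E)
    (hTE : IndepFun T E μ) {u : α → Fin n → ℝ} (hu : Measurable u)
    (hhalf : ∀ a : Fin n → ℝ, a ≠ 0 → 2⁻¹ ≤ μ {ω | 0 < ∑ i, a i * E ω i}) :
    2⁻¹ * μ {ω | u (T ω) ≠ 0} ≤ μ {ω | 0 < ∑ i, u (T ω) i * E ω i} := by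
  have hprod := (indepFun_iff_map_prod_eq_prod_map_map hT.aemeasurable hE.aemeasurable).1 hTE
  have := Measure.isProbabilityMeasure_map (μ := μ) hE.aemeasurable
  have hA : MeasurableSet {z : α × (Fin n → ℝ) | 0 < ∑ i, u z.1 i * z.2 i} :=
    measurableSet_lt measurable_const (Finset.measurable_sum _ fun i _ =>
      ((measurable_pi_apply i).comp (hu.comp measurable_fst)).mul
        ((measurable_pi_apply i).comp measurable_snd))
  have hB : MeasurableSet {z : α | u z ≠ 0} :=
    (hu (measurableSet_singleton 0)).compl
  have h1 : μ {ω | 0 < ∑ i, u (T ω) i * E ω i} =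
      ∫⁻ z, μ.map E {x | 0 < ∑ i, u z i * x i} ∂(μ.map T) := by
    have h : μ.map (fun ω => (T ω, E ω)) {z | 0 < ∑ i, u z.1 i * z.2 i} = _ :=
      Measure.map_apply (hT.prodMk hE) hA
    rw [hprod, Measure.prod_apply hA] at h
    exact h.symm
  have h2 : 2⁻¹ * μ {ω | u (T ω) ≠ 0} =
      ∫⁻ z, {z | u z ≠ 0}.indicator (fun _ => 2⁻¹) z ∂(μ.map T) := by
    rw [lintegral_indicator_const hB, Measure.map_apply hT hB]
    rfl
  rw [h1, h2]
  refine lintegral_mono fun z => ?_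
  by_cases hz : u z = 0
  · simp [hz]
  rw [Set.indicator_of_mem hz]
  refine (hhalf (u z) hz).trans_eq ?_
  rw [Measure.map_apply hE]
  · rfl
  · exact measurableSet_lt measurable_const (Finset.measurable_sum _ fun i _ =>
      (measurable_pi_apply i).const_mul _)

end SPAC

/-! ### Almost sure convergence of the Gram matrices. -/

namespace SPAC

variable {Ω : Type*} [MeasurableSpace Ω] {μ : Measure Ω} {p : ℕ} {Z : ℕ → Ω → Fin p → ℝ}

lemma ae_tendsto_average [IsProbabilityMeasure μ] (hZindep : iIndepFun Z μ)
    (hZident : ∀ i, IdentDistrib (Z i) (Z 0) μ μ)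
    {f : (Fin p → ℝ) → ℝ} (hf : Measurable f) (hint : Integrable (fun ω => f (Z 0 ω)) μ) :
    ∀ᵐ ω ∂μ, Tendsto (fun n : ℕ => (∑ i : Fin n, f (Z i ω)) / n) atTop
      (𝓝 (∫ ω, f (Z 0 ω) ∂μ)) := by
  have h := strong_law_ae_real (fun i ω => f (Z i ω)) hint
    (fun i j hij => (hZindep.indepFun hij).comp hf hf) fun i => (hZident i).comp hf
  filter_upwards [h] with ω hω
  refine hω.congr fun n => ?_
  rw [Finset.sum_range]

lemma integral_mul_eq_covMatrix [IsProbabilityMeasure μ] {W : Ω → Fin p → ℝ}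
    (hL2 : ∀ j, MemLp (fun ω => W ω j) 2 μ) (hmean : ∀ j, ∫ ω, W ω j ∂μ = 0) (j k : Fin p) :
    ∫ ω, W ω j * W ω k ∂μ = covMatrix μ W j k := by
  rw [covMatrix, Matrix.of_apply, covariance_eq_sub (hL2 j) (hL2 k), hmean, zero_mul, sub_zero]
  rfl

lemma ae_tendsto_gram_sampleMatrix [IsProbabilityMeasure μ] (hZindep : iIndepFun Z μ)
    (hZident : ∀ i, IdentDistrib (Z i) (Z 0) μ μ)
    (hZL2 : ∀ j, MemLp (fun ω => Z 0 ω j) 2 μ) (hZmean : ∀ j, ∫ ω, Z 0 ω j ∂μ = 0) :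
    ∀ᵐ ω ∂μ, Tendsto (fun n => gram (sampleMatrix Z n ω)) atTop (𝓝 (covMatrix μ (Z 0))) := by
  have h : ∀ j k, ∀ᵐ ω ∂μ, Tendsto (fun n => gram (sampleMatrix Z n ω) j k) atTop
      (𝓝 (covMatrix μ (Z 0) j k)) := by
    intro j k
    rw [← integral_mul_eq_covMatrix hZL2 hZmean]
    exact ae_tendsto_average hZindep hZident (f := fun z => z j * z k)
      ((measurable_pi_apply j).mul (measurable_pi_apply k)) ((hZL2 j).integrable_mul (hZL2 k))
  filter_upwards [ae_all_iff.2 fun j => ae_all_iff.2 (h j)] with ω hω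
  exact tendsto_pi_nhds.2 fun j => tendsto_pi_nhds.2 fun k => hω j k

lemma sum_centered_mul {n : ℕ} (hn : n ≠ 0) (a b : Fin n → ℝ) :
    (∑ i, (a i - (∑ l, a l) / n) * (b i - (∑ l, b l) / n)) / n =
      (∑ i, a i * b i) / n - (∑ l, a l) / n * ((∑ l, b l) / n) := by
  have hn' : (n : ℝ) ≠ 0 := by exact_mod_cast hn
  have h : ∑ i, (a i - (∑ l, a l) / n) * (b i - (∑ l, b l) / n) =
      ∑ i, a i * b i - (∑ l, a l) * ((∑ l, b l) / n) := by
    simp only [sub_mul, mul_sub, Finset.sum_sub_distrib, ← Finset.sum_mul, ← Finset.mul_sum,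
      Finset.sum_const, Finset.card_univ, Fintype.card_fin, nsmul_eq_mul]
    field_simp
    ring
  rw [h]
  field_simp

/-- The right side is the sample correlation written through raw averages, to which the strong law
applies. -/
lemma gram_standardize {n : ℕ} (hn : n ≠ 0) (A : Matrix (Fin n) (Fin p) ℝ) (j k : Fin p) :
    gram (standardize A) j k =
      (gram A j k - (∑ l, A l j) / n * ((∑ l, A l k) / n)) /
        (√(gram A j j - (∑ l, A l j) / n * ((∑ l, A l j) / n)) *
          √(gram A k k - (∑ l, A l k) / n * ((∑ l, A l k) / n))) := by
  simp only [gram, standardize, Matrix.of_apply]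
  rw [← sum_centered_mul hn (fun i => A i j) fun i => A i k,
    ← sum_centered_mul hn (fun i => A i j) fun i => A i j,
    ← sum_centered_mul hn (fun i => A i k) fun i => A i k, div_right_comm]
  simp only [pow_two]
  rw [Finset.sum_div (f := fun i => (A i j - (∑ l, A l j) / n) * (A i k - (∑ l, A l k) / n))]
  congr 1
  exact Finset.sum_congr rfl fun i _ => div_mul_div_comm _ _ _ _

lemma ae_tendsto_gram_standardize [IsProbabilityMeasure μ] (hZindep : iIndepFun Z μ)
    (hZident : ∀ i, IdentDistrib (Z i) (Z 0) μ μ)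
    (hZL2 : ∀ j, MemLp (fun ω => Z 0 ω j) 2 μ) (hZmean : ∀ j, ∫ ω, Z 0 ω j ∂μ = 0)
    (hdiag : ∀ j, covMatrix μ (Z 0) j j = 1) :
    ∀ᵐ ω ∂μ, Tendsto (fun n => gram (standardize (sampleMatrix Z n ω))) atTop
      (𝓝 (covMatrix μ (Z 0))) := by
  have hm : ∀ j, ∀ᵐ ω ∂μ, Tendsto (fun n : ℕ => (∑ i : Fin n, Z i ω j) / n) atTop (𝓝 0) := by
    intro j
    rw [← hZmean j]
    exact ae_tendsto_average hZindep hZident (f := fun z => z j)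
      (measurable_pi_apply j) ((hZL2 j).integrable (by norm_num))
  filter_upwards [ae_all_iff.2 hm,
    ae_tendsto_gram_sampleMatrix hZindep hZident hZL2 hZmean] with ω hω hg
  have hg' : ∀ j k, Tendsto (fun n => gram (sampleMatrix Z n ω) j k) atTop
      (𝓝 (covMatrix μ (Z 0) j k)) := fun j k =>
    tendsto_pi_nhds.1 (tendsto_pi_nhds.1 hg j) k
  refine tendsto_pi_nhds.2 fun j => tendsto_pi_nhds.2 fun k => ?_
  have h := ((hg' j k).sub ((hω j).mul (hω k))).div
    (((hg' j j).sub ((hω j).mul (hω j))).sqrt.mul ((hg' k k).sub ((hω k).mul (hω k))).sqrt)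
    (by simp [hdiag])
  simp only [hdiag, mul_zero, sub_zero, Real.sqrt_one, mul_one, div_one] at h
  refine h.congr' ?_
  filter_upwards [eventually_ne_atTop 0] with n hn
  exact (gram_standardize hn _ j k).symm

end SPAC

/-! ### The SPAC as a positive multiple of the regression coefficient. -/

namespace SPAC

variable {Ω : Type*} [MeasurableSpace Ω] {μ : Measure Ω} {p : ℕ} {W : Ω → Fin p → ℝ}

lemma sum_eq_add_sum_ne (j : Fin p) (f : Fin p → ℝ) :
    ∑ k, f k = f j + ∑ k : {k // k ≠ j}, f k := by
  rw [← Finset.add_sum_erase _ f (Finset.mem_univ j)]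
  congr 1
  exact Finset.sum_subtype _ (fun k => by simp) f

lemma covariance_linear_combination [IsProbabilityMeasure μ]
    (hL2 : ∀ j, MemLp (fun ω => W ω j) 2 μ) (a b : Fin p → ℝ) :
    covariance (fun ω => ∑ k, a k * W ω k) (fun ω => ∑ k, b k * W ω k) μ =
      a ⬝ᵥ covMatrix μ W *ᵥ b := by
  rw [covariance_fun_sum_fun_sum (fun i => (hL2 i).const_mul _) fun i => (hL2 i).const_mul _]
  simp only [dotProduct, Matrix.mulVec, Finset.mul_sum, covMatrix, Matrix.of_apply,
    covariance_const_mul_left, covariance_const_mul_right]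
  exact Finset.sum_congr rfl fun i _ => Finset.sum_congr rfl fun k _ => by ring

/-- The coefficient `1` at `j` makes the combination nontrivial, so a positive definite covariance
gives it positive variance. -/
lemma predError_self_eq (j : Fin p) :
    ∃ c : Fin p → ℝ, c j = 1 ∧
      predError μ W (fun ω => W ω j) j = fun ω => ∑ k, c k * W ω k := by
  refine ⟨fun k => if h : k = j then 1 else -predCoef μ W (fun ω => W ω j) j ⟨k, h⟩, by simp, ?_⟩
  funext ω
  rw [sum_eq_add_sum_ne j]
  simp only [predError, dif_pos, one_mul, sub_eq_add_neg, ← Finset.sum_neg_distrib]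
  congr 1
  exact Finset.sum_congr rfl fun k _ => by rw [dif_neg k.2, neg_mul]

lemma memLp_predError_self [IsProbabilityMeasure μ] (hL2 : ∀ j, MemLp (fun ω => W ω j) 2 μ)
    (j : Fin p) : MemLp (predError μ W (fun ω => W ω j) j) 2 μ := by
  obtain ⟨c, -, h⟩ := predError_self_eq (μ := μ) (W := W) j
  rw [h]
  exact memLp_finsetSum _ fun k _ => (hL2 k).const_mul _

lemma variance_predError_self_pos [IsProbabilityMeasure μ]
    (hL2 : ∀ j, MemLp (fun ω => W ω j) 2 μ) (hpos : (covMatrix μ W).PosDef) (j : Fin p) :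
    0 < variance (predError μ W (fun ω => W ω j) j) μ := by
  have hm := (memLp_predError_self hL2 j).aemeasurable
  obtain ⟨c, hc, h⟩ := predError_self_eq (μ := μ) (W := W) j
  rw [← covariance_self hm, h, covariance_linear_combination hL2]
  have hc0 : c ≠ 0 := fun h0 => by simp [h0] at hc
  simpa using hpos.dotProduct_mulVec_pos hc0

lemma covariance_linear_model [IsProbabilityMeasure μ]
    (hL2 : ∀ j, MemLp (fun ω => W ω j) 2 μ) {e : Ω → ℝ} (he : MemLp e 2 μ)
    (hcov : ∀ k, covariance (fun ω => W ω k) e μ = 0) (β : Fin p → ℝ) (k : Fin p) :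
    covariance (fun ω => W ω k) (fun ω => ∑ l, W ω l * β l + e ω) μ =
      ∑ l, covMatrix μ W k l * β l := by
  have h := covariance_add_right (hL2 k)
    (memLp_finsetSum Finset.univ fun l _ => (hL2 l).mul_const (β l)) he
  refine Eq.trans h ?_
  rw [hcov, add_zero, covariance_fun_sum_right (fun l => (hL2 l).mul_const (β l)) (hL2 k)]
  exact Finset.sum_congr rfl fun l _ => covariance_mul_const_right _

/-- Linear prediction reproduces the terms in `X_k`, `k ≠ j`, exactly and predicts the uncorrelated
noise by zero; only `β j • X_j` and the noise contribute to the error. -/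
lemma predError_linear_model [IsProbabilityMeasure μ]
    (hL2 : ∀ j, MemLp (fun ω => W ω j) 2 μ) (hpos : (covMatrix μ W).PosDef)
    {e : Ω → ℝ} (he : MemLp e 2 μ)
    (hcov : ∀ k, covariance (fun ω => W ω k) e μ = 0) (β : Fin p → ℝ) (j : Fin p) :
    predError μ W (fun ω => ∑ l, W ω l * β l + e ω) j =
      fun ω => β j * predError μ W (fun ω => W ω j) j ω + e ω := by
  set B := (covMatrix μ W).toBlock (fun k => k ≠ j) (fun k => k ≠ j) with hB
  have hdet : IsUnit B.det := by
    have : B.PosDef := hpos.submatrix Subtype.val_injective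
    exact this.det_pos.ne'.isUnit
  have hcoef : predCoef μ W (fun ω => ∑ l, W ω l * β l + e ω) j =
      (fun k : {k // k ≠ j} => β k) + β j • predCoef μ W (fun ω => W ω j) j := by
    have hv : (fun k : {k // k ≠ j} =>
        covariance (fun ω => W ω k) (fun ω => ∑ l, W ω l * β l + e ω) μ) =
        B *ᵥ (fun k : {k // k ≠ j} => β k) +
          β j • fun k : {k // k ≠ j} => covariance (fun ω => W ω k) (fun ω => W ω j) μ := by
      funext k
      rw [covariance_linear_model hL2 he hcov, sum_eq_add_sum_ne j, add_comm]
      simp only [Pi.add_apply, Pi.smul_apply, smul_eq_mul, Matrix.mulVec, dotProduct]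
      congr 1
      exact mul_comm _ _
    rw [predCoef, predCoef, hv, Matrix.mulVec_add, Matrix.mulVec_mulVec,
      Matrix.nonsing_inv_mul _ hdet, Matrix.one_mulVec, Matrix.mulVec_smul]
  funext ω
  simp only [predError, hcoef, Pi.add_apply, Pi.smul_apply, smul_eq_mul, add_mul,
    Finset.sum_add_distrib, mul_sub, Finset.mul_sum]
  rw [sum_eq_add_sum_ne j]
  simp only [mul_assoc, mul_comm (W ω _) (β _)]
  ring

/-- The two prediction errors have covariance `β j` times the variance of that of `X_j`; multiplying
the correlation by `s_j` cancels the standard deviation of that of `Y`. -/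
lemma spac_eq_mul_sqrt_variance [IsProbabilityMeasure μ]
    (hL2 : ∀ j, MemLp (fun ω => W ω j) 2 μ) (hpos : (covMatrix μ W).PosDef)
    {e : Ω → ℝ} (he : MemLp e 2 μ) (hvar : 0 < variance e μ)
    (hcov : ∀ k, covariance (fun ω => W ω k) e μ = 0) (β : Fin p → ℝ) (j : Fin p) :
    spac μ W (fun ω => ∑ k, W ω k * β k + e ω) j =
      β j * √(variance (predError μ W (fun ω => W ω j) j) μ) := by
  have hm := memLp_predError_self hL2 j
  have hv := variance_predError_self_pos hL2 hpos j
  have hce : covariance e (predError μ W (fun ω => W ω j) j) μ = 0 := by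
    obtain ⟨c, -, h⟩ := predError_self_eq (μ := μ) (W := W) j
    rw [h, covariance_fun_sum_right (fun k => (hL2 k).const_mul _) he]
    exact Finset.sum_eq_zero fun k _ => by
      rw [covariance_const_mul_right, covariance_comm, hcov, mul_zero]
  rw [spac, partialCorr, residualSD, corr, predError_linear_model hL2 hpos he hcov]
  set U := predError μ W (fun ω => W ω j) j with hU
  have hbU : MemLp (fun ω => β j * U ω) 2 μ := hm.const_mul _
  have h1 : covariance (fun ω => β j * U ω + e ω) U μ = β j * variance U μ := by
    refine (covariance_add_left hbU he hm).trans ?_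
    rw [hce, add_zero, covariance_const_mul_left, covariance_self hm.aemeasurable]
  -- The noise alone keeps this positive, also when `β j = 0`, so the cancellation is legitimate.
  have h2 : 0 < variance (fun ω => β j * U ω + e ω) μ := by
    have h := variance_fun_add hbU he
    rw [h, covariance_const_mul_left, covariance_comm, hce, variance_const_mul]
    nlinarith [mul_nonneg (sq_nonneg (β j)) (variance_nonneg U μ)]
  rw [h1]
  have h3 := Real.sqrt_pos.2 h2
  have h4 := Real.sqrt_pos.2 hv
  field_simp
  rw [Real.sq_sqrt hv.le]

end SPAC

/-! ### Measurability, and stability of a violated condition. -/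

namespace SPAC

variable {Ω : Type*} {n p : ℕ}

lemma continuous_gram : Continuous (gram : Matrix (Fin n) (Fin p) ℝ → _) := by
  refine continuous_pi fun j => continuous_pi fun k => ?_
  exact (continuous_finsetSum _ fun i _ =>
    (continuous_id.matrix_elem i j).mul (continuous_id.matrix_elem i k)).div_const _

lemma continuous_residColumn (P : Fin p → Prop) [DecidablePred P] (j : Fin p) :
    Continuous (residColumn P j : Matrix (Fin n) (Fin p) ℝ → _) :=
  continuous_id.matrix_mulVec ((continuous_residCoef P j).comp continuous_gram)

lemma measurable_residColumn (P : Fin p → Prop) [DecidablePred P] (j : Fin p) :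
    Measurable fun x : Fin n → Fin p → ℝ => residColumn P j (Matrix.of x) := by
  have h : Continuous fun x : Fin n → Fin p → ℝ => residColumn P j (Matrix.of x) :=
    continuous_residColumn P j
  exact h.measurable

lemma measurableSet_gram_mem {O : Set (Matrix (Fin p) (Fin p) ℝ)} (hO : IsOpen O) :
    MeasurableSet {x : Fin n → Fin p → ℝ | gram (Matrix.of x) ∈ O} := by
  have h : Continuous fun x : Fin n → Fin p → ℝ => gram (Matrix.of x) := continuous_gram
  exact (hO.preimage h).measurableSet

lemma measurable_standardize :
    Measurable fun (x : Fin n → Fin p → ℝ) i j => standardize (Matrix.of x) i j := by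
  refine measurable_pi_lambda _ fun i => measurable_pi_lambda _ fun j => ?_
  have h : ∀ i, Measurable fun x : Fin n → Fin p → ℝ => x i j := fun i =>
    (measurable_pi_apply j).comp (measurable_pi_apply i)
  have hm : Measurable fun x : Fin n → Fin p → ℝ => (∑ l, x l j) / n :=
    (Finset.measurable_sum _ fun l _ => h l).div_const _
  exact ((h i).sub hm).div
    (((Finset.measurable_sum _ fun l _ => ((h l).sub hm).pow_const 2).div_const _).sqrt)

/-- Factoring the design through the covariate sequence transfers the independence from the errors
to it. -/
lemma exists_measurable_design {Z : ℕ → Ω → Fin p → ℝ}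
    {X : (n : ℕ) → Ω → Matrix (Fin n) (Fin p) ℝ}
    (hX : (∀ n ω, X n ω = sampleMatrix Z n ω) ∨ (∀ n ω, X n ω = standardize (sampleMatrix Z n ω)))
    (n : ℕ) :
    ∃ x : (ℕ → Fin p → ℝ) → Fin n → Fin p → ℝ, Measurable x ∧
      ∀ ω, X n ω = Matrix.of (x fun i => Z i ω) := by
  have h : Measurable fun (z : ℕ → Fin p → ℝ) (i : Fin n) => z i :=
    measurable_pi_lambda _ fun i => measurable_pi_apply _
  rcases hX with hX | hX
  · exact ⟨_, h, fun ω => hX n ω⟩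
  · exact ⟨_, measurable_standardize.comp h, fun ω => hX n ω⟩

variable [MeasurableSpace Ω] {μ : Measure Ω}

lemma tendsto_measure_notMem_of_ae_tendsto [IsProbabilityMeasure μ] {α : Type*}
    [TopologicalSpace α] {f : ℕ → Ω → α} {a : α} (h : ∀ᵐ ω ∂μ, Tendsto (fun n => f n ω) atTop (𝓝 a))
    {U : Set α} (hU : U ∈ 𝓝 a) (hm : ∀ n, MeasurableSet {ω | f n ω ∉ U}) :
    Tendsto (fun n => μ {ω | f n ω ∉ U}) atTop (𝓝 0) := by
  rw [← measure_empty (μ := μ)]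
  refine tendsto_measure_of_ae_tendsto_indicator_of_isFiniteMeasure _ MeasurableSet.empty hm ?_
  filter_upwards [h] with ω hω
  filter_upwards [hω.eventually_mem hU] with n hn
  simp [hn]

lemma tendsto_measure_notMem_of_tendstoInMeasure {dh : ℕ → Ω → Fin p → ℝ} {d : Fin p → ℝ}
    (hd : TendstoInMeasure μ (fun (n : ℕ) ω => √(n : ℝ) * ⨆ j, |dh n ω j - d j|) atTop
      (fun _ => (0 : ℝ))) {U : Set (Fin p → ℝ)} (hU : U ∈ 𝓝 d) :
    Tendsto (fun n => μ {ω | dh n ω ∉ U}) atTop (𝓝 0) := by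
  obtain ⟨δ, hδ, hball⟩ := Metric.mem_nhds_iff.1 hU
  refine tendsto_of_tendsto_of_tendsto_of_le_of_le' tendsto_const_nhds
    (tendstoInMeasure_iff_dist.1 hd δ hδ) (Eventually.of_forall fun _ => zero_le) ?_
  filter_upwards [eventually_ge_atTop 1] with n hn
  refine measure_mono fun ω hω => ?_
  have h1 : δ ≤ dist (dh n ω) d := not_lt.1 fun h => hω (hball h)
  have h0 : 0 ≤ ⨆ j, |dh n ω j - d j| := Real.iSup_nonneg fun j => abs_nonneg _
  have h2 : dist (dh n ω) d ≤ ⨆ j, |dh n ω j - d j| :=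
    (dist_pi_le_iff h0).2 fun j =>
      le_ciSup (f := fun j => |dh n ω j - d j|) (Set.finite_range _).bddAbove j
  have h3 : 1 ≤ √(n : ℝ) := Real.one_le_sqrt.2 (by exact_mod_cast hn)
  -- Since `√n ≥ 1`, the rate implies plain consistency.
  have h4 : ⨆ j, |dh n ω j - d j| ≤ √(n : ℝ) * ⨆ j, |dh n ω j - d j| :=
    le_mul_of_one_le_left h0 h3
  change δ ≤ dist _ _
  rw [Real.dist_0_eq_abs]
  exact (h1.trans (h2.trans h4)).trans (le_abs_self _)

/-- The pairs of a Gram matrix and scales `d` for which the irrepresentable condition at `j` is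
violated with sign `σ`, and the relevant matrices are nondegenerate. -/
def violationSet (P : Fin p → Prop) [DecidablePred P] (j : Fin p) (s : Fin p → ℝ) (σ : ℝ) :
    Set (Matrix (Fin p) (Fin p) ℝ × (Fin p → ℝ)) :=
  {z | 0 < (z.1.toBlock P P).det ∧ z.1.det ≠ 0 ∧ (∀ k, 0 < z.2 k) ∧
    (z.1.toBlock P P).det * √(z.2 j) < σ * ∑ k : {k // P k}, √(z.2 k) * s k * projCoef P j z.1 k}

lemma isOpen_violationSet (P : Fin p → Prop) [DecidablePred P] (j : Fin p) (s : Fin p → ℝ)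
    (σ : ℝ) : IsOpen (violationSet P j s σ) := by
  have hdet : Continuous fun z : Matrix (Fin p) (Fin p) ℝ × (Fin p → ℝ) =>
      (z.1.toBlock P P).det := (continuous_fst.matrix_submatrix _ _).matrix_det
  have hz : ∀ k, Continuous fun z : Matrix (Fin p) (Fin p) ℝ × (Fin p → ℝ) => z.2 k :=
    fun k => (continuous_apply k).comp continuous_snd
  have hpos : IsOpen {z : Matrix (Fin p) (Fin p) ℝ × (Fin p → ℝ) | ∀ k, 0 < z.2 k} := by
    rw [Set.ofPred_forall]
    exact isOpen_iInter_of_finite fun k => isOpen_lt continuous_const (hz k)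
  refine (isOpen_lt continuous_const hdet).inter ((isOpen_ne_fun continuous_fst.matrix_det
    continuous_const).inter (hpos.inter (isOpen_lt (hdet.mul (hz j).sqrt)
      (continuous_const.mul (continuous_finsetSum _ fun k _ => ((hz k).sqrt.mul
        continuous_const).mul ((continuous_apply k).comp
          ((continuous_projCoef P j).comp continuous_fst)))))))

/-- Multiplying the failed inequality by `√d_jj` and by the determinant of the active block clears
`V(2)` and turns `C₁₁⁻¹` into the adjugate. Symmetry of `C` identifies row `j` of `C₂₁` with the
column used in `projCoef`. -/
lemma exists_sign_mem_violationSet {q : ℕ} {C : Matrix (Fin p) (Fin p) ℝ} (hC : C.PosDef)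
    {γ : Fin p → ℝ} (h : ¬ WeakIrrepresentable q C γ) :
    ∃ j : Fin p, ¬ (j : ℕ) < q ∧ ∃ σ : ℝ, |σ| = 1 ∧
      (C, fun k => (C⁻¹) k k) ∈ violationSet (fun k => (k : ℕ) < q) j
        (fun k => Real.sign (γ k)) σ := by
  simp only [WeakIrrepresentable, not_forall, not_le] at h
  obtain ⟨⟨j, hj⟩, h⟩ := h
  have hd : ∀ k, 0 < (C⁻¹) k k := fun k => hC.inv.diag_pos
  set P : Fin p → Prop := fun k => (k : ℕ) < q with hP
  set B := C.toBlock P P with hB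
  have hBpos : B.PosDef := hC.submatrix Subtype.val_injective
  have hdet := hBpos.det_pos
  set w : {k // P k} → ℝ := fun k => √((C⁻¹) k k) * Real.sign (γ k) with hw
  set x := (fun k : {k // P k} => C k j) ⬝ᵥ B⁻¹ *ᵥ w with hx
  have hV : ((scaleMatrix C).toBlock P P)⁻¹ =
      Matrix.diagonal fun k : {k // P k} => √((C⁻¹) k k) := by
    apply Matrix.inv_eq_right_inv
    rw [scaleMatrix, Matrix.toBlock_diagonal_self, Matrix.diagonal_mul_diagonal,
      ← Matrix.diagonal_one]
    congr 1
    funext k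
    rw [← Real.sqrt_mul (by have := hd k; positivity), one_div_mul_cancel (hd k).ne', Real.sqrt_one]
  rw [hV, ← Matrix.mulVec_mulVec, ← Matrix.mulVec_mulVec, ← Matrix.mulVec_mulVec, scaleMatrix,
    Matrix.toBlock_diagonal_self, Matrix.mulVec_diagonal] at h
  have hval : (C.toBlock (fun k => ¬ P k) P *ᵥ B⁻¹ *ᵥ Matrix.diagonal
      (fun k : {k // P k} => √((C⁻¹) k k)) *ᵥ fun k => Real.sign (γ k)) ⟨j, hj⟩ = x := by
    have hsym : ∀ k, C j k = C k j := fun k => by simpa using hC.1.apply k j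
    have hdw : (Matrix.diagonal (fun k : {k // P k} => √((C⁻¹) k k)) *ᵥ fun k =>
        Real.sign (γ k)) = w := by
      funext k
      rw [Matrix.mulVec_diagonal]
    rw [hdw, hx, Matrix.mulVec, dotProduct, dotProduct]
    exact Finset.sum_congr rfl fun k _ => by rw [← hsym]; rfl
  rw [hval, abs_mul, abs_of_nonneg (Real.sqrt_nonneg _)] at h
  have hx1 : √((C⁻¹) j j) < |x| := by
    have hs := Real.sqrt_pos.2 (hd j)
    rw [one_div, Real.sqrt_inv, inv_mul_eq_div, lt_div_iff₀ hs, one_mul] at h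
    exact h
  have hsum : ∑ k : {k // P k}, √((C⁻¹) k k) * Real.sign (γ k) * projCoef P j C k =
      B.det * x := by
    have hadj : B.adjugate = B.det • B⁻¹ := by
      rw [Matrix.inv_def, smul_smul, Ring.mul_inverse_cancel _ hdet.ne'.isUnit, one_smul]
    have hinv : (B⁻¹)ᵀ = B⁻¹ := hBpos.1.inv
    have : w ⬝ᵥ projCoef P j C = B.det * x := by
      rw [projCoef, hadj, Matrix.smul_mulVec, dotProduct_smul, smul_eq_mul, hx,
        Matrix.dotProduct_mulVec, ← Matrix.mulVec_transpose, hinv, dotProduct_comm]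
    exact this
  have hx0 : x ≠ 0 := by
    rintro h0
    rw [h0, abs_zero] at hx1
    exact (Real.sqrt_nonneg _).not_gt hx1
  -- The sign of `x` turns `|x|` into `σ x`.
  refine ⟨j, hj, SignType.sign x, ?_, hdet, hC.det_pos.ne', hd, ?_⟩
  · rcases hx0.lt_or_gt with h0 | h0 <;> simp [h0]
  · change B.det * _ < _ * (∑ k : {k // P k}, √((C⁻¹) k k) * Real.sign (γ k) * projCoef P j C k)
    rw [hsum, mul_left_comm, sign_mul_self]
    exact mul_lt_mul_of_pos_left hx1 hdet

end SPAC

/-! ### The main theorem. -/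

theorem theorem2 {Ω : Type*} [MeasurableSpace Ω] (μ : Measure Ω) [IsProbabilityMeasure μ]
    (p q : ℕ) (hq : 1 ≤ q) (hqp : q ≤ p)
    -- independent copies of the covariate vector: mean zero, covariance matrix `C`
    (C : Matrix (Fin p) (Fin p) ℝ) (hCpos : C.PosDef) (hCdiag : ∀ j, C j j = 1)
    (Z : ℕ → Ω → Fin p → ℝ) (hZmeas : ∀ i, Measurable (Z i)) (hZindep : iIndepFun Z μ)
    (hZident : ∀ i, IdentDistrib (Z i) (Z 0) μ μ)
    (hZL2 : ∀ j, MemLp (fun ω => Z 0 ω j) 2 μ)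
    (hZmean : ∀ j, ∫ ω, Z 0 ω j ∂μ = 0)
    (hZcov : SPAC.covMatrix μ (Z 0) = C)
    -- Gaussian errors with positive variance `v`, independent of the covariates
    (v : ℝ≥0) (hv : 0 < v)
    (ε : ℕ → Ω → ℝ) (hεmeas : ∀ i, Measurable (ε i)) (hεindep : iIndepFun ε μ)
    (hεlaw : ∀ i, μ.map (ε i) = gaussianReal 0 v)
    (hZε : IndepFun (fun ω i => Z i ω) (fun ω i => ε i ω) μ)
    -- exactly the first `q` coefficients are nonzero
    (β : Fin p → ℝ) (hβ : ∀ j, β j ≠ 0 ↔ (j : ℕ) < q)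
    -- the vector of SPACs between `Y = 𝒳 β + ε` and the covariates
    (γ : Fin p → ℝ)
    (hγ : ∀ j, γ j = SPAC.spac μ (Z 0) (fun ω => ∑ k, Z 0 ω k * β k + ε 0 ω) j)
    -- the design matrices: the samples themselves, or the samples standardized by columns
    (X : (n : ℕ) → Ω → Matrix (Fin n) (Fin p) ℝ)
    (hX : (∀ n ω, X n ω = SPAC.sampleMatrix Z n ω) ∨
      (∀ n ω, X n ω = SPAC.standardize (SPAC.sampleMatrix Z n ω)))
    (y : (n : ℕ) → Ω → Fin n → ℝ)
    (hy : ∀ n ω i, y n ω i = ∑ j, X n ω i j * β j + ε i ω)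
    -- the maximal squared row norm is `o_p(n)`
    (hC3 : TendstoInMeasure μ (fun (n : ℕ) ω => (⨆ i, ∑ j, X n ω i j ^ 2) / (n : ℝ)) atTop
      (fun _ => (0 : ℝ)))
    -- the estimators of the diagonal of `C⁻¹`, with maximal error `o_p(1 / √n)`
    (dh : ℕ → Ω → Fin p → ℝ) (hdmeas : ∀ n, Measurable (dh n))
    (hd : TendstoInMeasure μ (fun (n : ℕ) ω => √(n : ℝ) * ⨆ j, |dh n ω j - (C⁻¹) j j|) atTop
      (fun _ => (0 : ℝ)))
    (hcons : SPAC.GeneralSignConsistent μ X y dh γ) :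
    SPAC.WeakIrrepresentable q C γ := by
  have hεL2 := SPAC.memLp_two_of_gaussian (hεmeas 0) (hεlaw 0)
  have hγsign : ∀ j, γ j ≠ 0 ↔ (j : ℕ) < q := by
    intro j
    have hcov : ∀ k, covariance (fun ω => Z 0 ω k) (ε 0) μ = 0 := by
      intro k
      have h : IndepFun (fun ω => Z 0 ω k) (ε 0) μ :=
        hZε.comp (φ := fun z : ℕ → Fin p → ℝ => z 0 k) (ψ := fun e : ℕ → ℝ => e 0)
          ((measurable_pi_apply k).comp (measurable_pi_apply 0)) (measurable_pi_apply 0)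
      exact h.covariance_eq_zero (hZL2 k) hεL2
    have hvar : 0 < variance (ε 0) μ := by
      rw [SPAC.variance_of_gaussian (hεmeas 0) (hεlaw 0)]
      exact hv
    rw [hγ, SPAC.spac_eq_mul_sqrt_variance hZL2 (hZcov ▸ hCpos) hεL2 hvar hcov, ← hβ j,
      mul_ne_zero_iff, and_iff_left]
    exact (Real.sqrt_pos.2 (SPAC.variance_predError_self_pos hZL2 (hZcov ▸ hCpos) j)).ne'
  have hgram : ∀ᵐ ω ∂μ, Tendsto (fun n => SPAC.gram (X n ω)) atTop (𝓝 C) := by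
    rw [← hZcov]
    rcases hX with hX | hX
    · simpa only [hX] using
        SPAC.ae_tendsto_gram_sampleMatrix hZindep hZident hZL2 hZmean
    · simpa only [hX] using
        SPAC.ae_tendsto_gram_standardize hZindep hZident hZL2 hZmean
          fun j => by rw [hZcov, hCdiag]
  by_contra hweak
  obtain ⟨j, hj, σ, hσ, hmem⟩ := SPAC.exists_sign_mem_violationSet hCpos hweak
  set P : Fin p → Prop := fun k => (k : ℕ) < q with hP
  set s : Fin p → ℝ := fun k => Real.sign (γ k) with hs
  set V := SPAC.violationSet P j s σ with hV
  choose x hxm hx using SPAC.exists_measurable_design hX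
  have hT : Measurable fun ω i => Z i ω := measurable_pi_lambda _ hZmeas
  have hσ0 : σ ≠ 0 := fun h => by simp [h] at hσ
  set E : ℕ → Set Ω := fun n => {ω | ∃ lam : ℝ, 0 ≤ lam ∧ ∃ g : Fin p → ℝ,
    SPAC.IsSPACLasso (X n ω) (y n ω) (dh n ω) lam g ∧
      ∀ j, Real.sign (g j) = Real.sign (γ j)} with hE
  set F : ℕ → Set Ω := fun n =>
    {ω | 0 < ∑ i, (σ • SPAC.residColumn P j (X n ω)) i * ε i ω} with hF
  set B : ℕ → Set Ω := fun n => {ω | (SPAC.gram (X n ω), dh n ω) ∉ V} with hB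
  -- Off the bad event `B n`, sign recovery and a noise projection of sign `σ` exclude each other.
  have hEFB : ∀ n, E n ∩ F n ⊆ B n := by
    rintro n ω ⟨⟨lam, hlam, g, hmin, hsign⟩, hpos⟩ ⟨h1, -, h3, h4⟩
    have hg : ∀ k, g k ≠ 0 ↔ P k := fun k => by
      refine Iff.trans ?_ (hγsign k)
      rw [not_iff_not, ← Real.sign_eq_zero_iff, hsign, Real.sign_eq_zero_iff]
    have := hmin.sum_residColumn_mul_nonpos (P := P) (e := fun i => ε i ω) (s := s) hlam (hy n ω) h3
      (fun k hk => ⟨(hg k).2 hk, hsign k⟩) (fun k hk => not_not.1 fun h => hk ((hg k).1 h))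
      (fun k hk => not_not.1 fun h => hk ((hβ k).1 h)) hj hσ h1.le h4.le
    rw [Finset.mul_sum] at this
    refine absurd hpos (not_lt.2 (le_trans (le_of_eq ?_) this))
    exact Finset.sum_congr rfl fun i _ => mul_assoc _ _ _
  have hFhalf : ∀ n, 2⁻¹ * μ {ω | σ • SPAC.residColumn P j (X n ω) ≠ 0} ≤ μ (F n) := by
    intro n
    have hu : Measurable fun z => σ • SPAC.residColumn P j (Matrix.of (x n z)) :=
      ((SPAC.measurable_residColumn P j).comp (hxm n)).const_smul σ
    have hind : IndepFun (fun ω i => Z i ω) (fun ω (i : Fin n) => ε i ω) μ :=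
      hZε.comp (φ := id) (ψ := fun (e : ℕ → ℝ) (i : Fin n) => e i) measurable_id
        (measurable_pi_lambda _ fun i => measurable_pi_apply _)
    simp only [hF, hx]
    exact SPAC.half_mul_measure_le_of_indepFun hT
      (measurable_pi_lambda _ fun i => hεmeas i) hind hu fun a ha =>
        (SPAC.measure_sum_mul_gaussian_pos (e := fun (i : Fin n) => ε i) hv (fun i => hεmeas i)
          (hεindep.precomp Fin.val_injective) (fun i => hεlaw i) ha).ge
  have hFmeas : ∀ n, MeasurableSet (F n) := by
    intro n
    have hu : Measurable fun ω => σ • SPAC.residColumn P j (X n ω) := by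
      simp only [hx]
      exact (((SPAC.measurable_residColumn P j).comp (hxm n)).const_smul σ).comp hT
    exact measurableSet_lt measurable_const (Finset.measurable_sum _ fun i _ =>
      ((measurable_pi_apply i).comp hu).mul (hεmeas i))
  have hBlim : Tendsto (fun n => μ (B n)) atTop (𝓝 0) := by
    obtain ⟨U₁, hU₁, U₂, hU₂, hU⟩ := mem_nhds_prod_iff.1
      ((SPAC.isOpen_violationSet P j s σ).mem_nhds hmem)
    obtain ⟨O, hOU, hO, hCO⟩ := mem_nhds_iff.1 hU₁
    have h1 := SPAC.tendsto_measure_notMem_of_ae_tendsto hgram (hO.mem_nhds hCO) fun n => by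
      simp only [hx]
      exact (hT (hxm n (SPAC.measurableSet_gram_mem hO))).compl
    have h2 := SPAC.tendsto_measure_notMem_of_tendstoInMeasure hd hU₂
    have h12 := h1.add h2
    rw [add_zero] at h12
    refine tendsto_of_tendsto_of_tendsto_of_le_of_le tendsto_const_nhds h12
      (fun _ => zero_le) fun n => (measure_mono fun ω hω => ?_).trans (measure_union_le _ _)
    by_contra hcon
    simp only [Set.mem_union, Set.mem_ofPred_eq, not_or, not_not] at hcon
    exact hω (hU ⟨hOU hcon.1, hcon.2⟩)
  have hne : ∀ n, 1 ≤ μ {ω | σ • SPAC.residColumn P j (X n ω) ≠ 0} + μ (B n) := by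
    intro n
    rw [← measure_univ (μ := μ)]
    refine (measure_mono fun ω _ => ?_).trans (measure_union_le _ _)
    by_cases hω : (SPAC.gram (X n ω), dh n ω) ∈ V
    · exact Or.inl (smul_ne_zero hσ0 (SPAC.residColumn_ne_zero P hj hω.1.ne' hω.2.1))
    · exact Or.inr hω
  -- The sets `E n` and `B n` enter only through monotonicity and union bounds, valid for outer
  -- measure; only `F n` is complemented and must be measurable.
  have hbound : ∀ n, μ (E n) + 2⁻¹ ≤ 1 + μ (B n) + 2⁻¹ * μ (B n) := by
    intro n
    have h1 : μ (E n) ≤ μ (B n) + μ (F n)ᶜ := by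
      refine (measure_mono fun ω hω => ?_).trans (measure_union_le _ _)
      by_cases hωF : ω ∈ F n
      · exact Or.inl (hEFB n ⟨hω, hωF⟩)
      · exact Or.inr hωF
    have h2 : 2⁻¹ ≤ μ (F n) + 2⁻¹ * μ (B n) := by
      calc (2⁻¹ : ℝ≥0∞) = 2⁻¹ * 1 := (mul_one _).symm
        _ ≤ 2⁻¹ * (μ {ω | σ • SPAC.residColumn P j (X n ω) ≠ 0} + μ (B n)) := by
          gcongr
          exact hne n
        _ ≤ _ := by
          rw [mul_add]
          gcongr
          exact hFhalf n
    calc μ (E n) + 2⁻¹ ≤ (μ (B n) + μ (F n)ᶜ) + (μ (F n) + 2⁻¹ * μ (B n)) := add_le_add h1 h2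
      _ = (μ (F n) + μ (F n)ᶜ) + μ (B n) + 2⁻¹ * μ (B n) := by ring
      _ = _ := by rw [prob_add_prob_compl (hFmeas n)]
  have hlim1 : Tendsto (fun n => μ (E n) + 2⁻¹) atTop (𝓝 (1 + 2⁻¹)) :=
    Tendsto.add hcons tendsto_const_nhds
  have hlim2 : Tendsto (fun n => 1 + μ (B n) + 2⁻¹ * μ (B n)) atTop (𝓝 (1 + 0 + 2⁻¹ * 0)) :=
    (tendsto_const_nhds.add hBlim).add (ENNReal.Tendsto.const_mul hBlim (Or.inr (by simp)))
  -- In the limit this reads `1 + 1/2 ≤ 1`.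
  have hle := le_of_tendsto_of_tendsto' hlim1 hlim2 hbound
  rw [mul_zero, add_zero, add_zero] at hle
  exact (ENNReal.lt_add_right ENNReal.one_ne_top (by simp : (2⁻¹ : ℝ≥0∞) ≠ 0)).not_ge hle
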